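/- Let $d>1$ be an integer and equip $\mathbb R^d$ with the Euclidean norm $\|\cdot\|$. For probability measures $\pi_1,\pi_2$ on $\mathbb R^d$ let $$W_1(\pi_1,\pi_2)=\inf_{\pi\in\Pi(\pi_1,\pi_2)}\int_{\mathbb R^d\times\mathbb R^d}\|x-y\|\,\mathrm d\pi(x,y)\in[0,\infty],$$ where $\Pi(\pi_1,\pi_2)$ is the set of probability measures on $\mathbb R^d\times\mathbb R^d$ with marginals $\pi_1$ and $\pi_2$. For $K>0$ let $\mathrm{Lip}_K([0,1],\mathbb R^d)$ be the set of $K$-Lipschitz functions $G:[0,1]\to\mathbb R^d$, and let $G_{\sharp U}$ denote the image under $G$ of the uniform distribution on $[0,1]$. Let $\mu$ be a probability measure on $\mathbb R^d$ with $\int\|x\|\,\mu(\mathrm dx)<\infty$ whose support $S(\mu)=\{x\in\mathbb R^d:\mu(B(x,\varepsilon))>0\text{ for all }\varepsilon>0\}$, where $B(x,\varepsilon)$ is the closed ball of centre $x$ and radius $\varepsilon$, has positive Lebesgue measure. Let $X_1,X_2,\dots$ be i.i.d. random variables with distribution $\mu$, and let $\mu_n=\frac1n\sum_{i=1}^n\delta_{X_i}$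 for $n\ge1$. **Theorem.** For every $K>0$ and every (possibly random) choice, for each $n\ge1$, of a function $\widehat G_{K}=\widehat G_{K,n}\in\mathrm{Lip}_K([0,1],\mathbb R^d)$ such that almost surely, for all $n\geq 1$, $$W_1(\widehat G_{K\sharp U},\mu_n)=\inf_{G\in\mathrm{Lip}_K([0,1],\mathbb R^d)}W_1(G_{\sharp U},\mu_n),$$ one has $$\liminf_{n\to\infty}W_1(\widehat G_{K\sharp U},\mu)>0\quad\text{almost surely.}$$ -/

import Mathlib

open MeasureTheory ProbabilityTheory Filter
open scoped ENNReal NNReal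

noncomputable section

/-- The set `Π(π₁, π₂)` of joint probability measures on `ℝᵈ × ℝᵈ` with marginals `π₁`, `π₂`. -/
def couplings {d : ℕ} (π₁ π₂ : Measure (EuclideanSpace ℝ (Fin d))) :
    Set (Measure (EuclideanSpace ℝ (Fin d) × EuclideanSpace ℝ (Fin d))) :=
  {π | IsProbabilityMeasure π ∧ π.fst = π₁ ∧ π.snd = π₂}

/-- The `1`-Wasserstein distance for the Euclidean norm, with values in `[0, ∞]`. -/
def W1 {d : ℕ} (π₁ π₂ : Measure (EuclideanSpace ℝ (Fin d))) : ℝ≥0∞ :=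
  ⨅ π ∈ couplings π₁ π₂, ∫⁻ z, ‖z.1 - z.2‖ₑ ∂π

/-- The empirical measure `(1/n) ∑ δ_{xᵢ}` of the first `n` terms of a sequence (for `n ≥ 1`). -/
def empiricalMeasure {d : ℕ} (x : ℕ → EuclideanSpace ℝ (Fin d)) (n : ℕ) :
    Measure (EuclideanSpace ℝ (Fin d)) :=
  (n : ℝ≥0∞)⁻¹ • ∑ i ∈ Finset.range n, Measure.dirac (x i)

/-- The class `Lip_K([0,1], ℝᵈ)`. -/
def lipClass (d : ℕ) (K : ℝ≥0) : Set (unitInterval → EuclideanSpace ℝ (Fin d)) :=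
  {G | LipschitzWith K G}

/-- The pushforward `G_{♯U}` of the uniform distribution on `[0,1]` (the Lebesgue measure). -/
def pushUniform {d : ℕ} (G : unitInterval → EuclideanSpace ℝ (Fin d)) :
    Measure (EuclideanSpace ℝ (Fin d)) :=
  (volume : Measure unitInterval).map G

/-- The set of minimizers over `G ∈ Lip_K([0,1], ℝᵈ)` of `W₁(G_{♯U}, ν)`. -/
def wganMinimizers {d : ℕ} (K : ℝ≥0) (ν : Measure (EuclideanSpace ℝ (Fin d))) :
    Set (unitInterval → EuclideanSpace ℝ (Fin d)) :=
  {G | G ∈ lipClass d K ∧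
    W1 (pushUniform G) ν = ⨅ G' ∈ lipClass d K, W1 (pushUniform G') ν}

end

/-- The `K/N`-neighbourhood of a `K`-Lipschitz curve has volume at most that of `N + 1` balls of
radius `2K/N`. -/
theorem volume_setOf_dist_range_le {d : ℕ} {K : ℝ≥0} {G : unitInterval → EuclideanSpace ℝ (Fin d)}
    (hG : LipschitzWith K G) {N : ℕ} (hN : 0 < N) :
    volume {y | ∃ t, dist y (G t) ≤ K / N} ≤
      (N + 1 : ℕ) * volume (Metric.closedBall (0 : EuclideanSpace ℝ (Fin d)) (2 * K / N)) := by
  have hN' : (0 : ℝ) < N := by exact_mod_cast hN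
  -- Images of the grid points `i/N`, `0 ≤ i ≤ N`; for these `i`, `projIcc` does not move `i/N`.
  let p : ℕ → EuclideanSpace ℝ (Fin d) := fun i => G (Set.projIcc 0 1 zero_le_one ((i : ℝ) / N))
  have hsub : {y | ∃ t, dist y (G t) ≤ K / N} ⊆
      ⋃ i ∈ Finset.range (N + 1), Metric.closedBall (p i) (2 * K / N) := by
    rintro y ⟨t, ht⟩
    have ht0 : 0 ≤ (t : ℝ) * N := mul_nonneg t.2.1 hN'.le
    have hfl : (⌊(t : ℝ) * N⌋₊ : ℝ) ≤ t * N := Nat.floor_le ht0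
    have hlt : (t : ℝ) * N < ⌊(t : ℝ) * N⌋₊ + 1 := Nat.lt_floor_add_one _
    have hle : (⌊(t : ℝ) * N⌋₊ : ℝ) ≤ N := hfl.trans (by nlinarith [t.2.2])
    have hmem : (⌊(t : ℝ) * N⌋₊ : ℝ) / N ∈ Set.Icc (0 : ℝ) 1 :=
      ⟨by positivity, by rw [div_le_one hN']; exact hle⟩
    have hdist : dist t (Set.projIcc 0 1 zero_le_one ((⌊(t : ℝ) * N⌋₊ : ℝ) / N)) ≤ 1 / N := by
      rw [Subtype.dist_eq, Set.projIcc_of_mem _ hmem, Real.dist_eq, abs_le]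
      constructor
      · have : (⌊(t : ℝ) * N⌋₊ : ℝ) / N ≤ t := by rw [div_le_iff₀ hN']; exact hfl
        have : 0 ≤ 1 / (N : ℝ) := by positivity
        linarith
      · have : (t : ℝ) ≤ (⌊(t : ℝ) * N⌋₊ + 1) / N := by rw [le_div_iff₀ hN']; exact hlt.le
        rw [add_div] at this
        linarith
    simp only [Set.mem_iUnion, Finset.mem_range, Metric.mem_closedBall]
    refine ⟨⌊(t : ℝ) * N⌋₊, Nat.lt_succ_of_le (by exact_mod_cast hle), ?_⟩
    calc dist y (p ⌊(t : ℝ) * N⌋₊) ≤ dist y (G t) + dist (G t) (p ⌊(t : ℝ) * N⌋₊) :=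
          dist_triangle _ _ _
      _ ≤ K / N + K * (1 / N) :=
          add_le_add ht ((hG.dist_le_mul _ _).trans (mul_le_mul_of_nonneg_left hdist K.2))
      _ = 2 * K / N := by ring
  calc volume {y | ∃ t, dist y (G t) ≤ K / N}
      ≤ ∑ i ∈ Finset.range (N + 1), volume (Metric.closedBall (p i) (2 * K / N)) :=
        (measure_mono hsub).trans (measure_biUnion_finset_le _ _)
    _ = _ := by
        simp [Measure.addHaar_closedBall_center]

/-- In dimension at least two, the total volume of `N + 1` balls of radius `C/N` tends to `0`. -/
theorem tendsto_mul_volume_closedBall_div {d : ℕ} (hd : 1 < d) {C : ℝ} (hC : 0 ≤ C) :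
    Tendsto (fun N : ℕ => ((N + 1 : ℕ) : ℝ≥0∞) *
      volume (Metric.closedBall (0 : EuclideanSpace ℝ (Fin d)) (C / N))) atTop (nhds 0) := by
  have hreal : Tendsto (fun N : ℕ => ((N : ℝ) + 1) * (C / N) ^ d) atTop (nhds 0) := by
    have hlim : Tendsto (fun N : ℕ => 2 * C ^ d / (N : ℝ)) atTop (nhds 0) :=
      tendsto_const_div_atTop_nhds_zero_nat _
    refine squeeze_zero' (Eventually.of_forall fun N => by positivity) ?_ hlim
    filter_upwards [eventually_ge_atTop 1] with N hN
    have hN1 : (1 : ℝ) ≤ N := by exact_mod_cast hN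
    -- Here `d ≥ 2` enters: one factor `1/N` is left over after summing about `N` balls.
    have hpow : (N : ℝ) ^ 2 ≤ (N : ℝ) ^ d := pow_le_pow_right₀ hN1 hd
    have hCd : 0 ≤ C ^ d := by positivity
    rw [div_pow, mul_div_assoc', div_le_div_iff₀ (by positivity) (by positivity)]
    calc ((N : ℝ) + 1) * C ^ d * N = C ^ d * (((N : ℝ) + 1) * N) := by ring
      _ ≤ C ^ d * (2 * (N : ℝ) ^ 2) := mul_le_mul_of_nonneg_left (by nlinarith) hCd
      _ ≤ C ^ d * (2 * (N : ℝ) ^ d) := by gcongr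
      _ = 2 * C ^ d * (N : ℝ) ^ d := by ring
  have hlim := ENNReal.Tendsto.mul_const (b := volume (Metric.ball (0 : EuclideanSpace ℝ (Fin d)) 1))
    (ENNReal.tendsto_ofReal hreal) (Or.inr measure_ball_lt_top.ne)
  rw [ENNReal.ofReal_zero, zero_mul] at hlim
  refine hlim.congr fun N => ?_
  rw [Measure.addHaar_closedBall _ _ (by positivity), finrank_euclideanSpace_fin, ← mul_assoc,
    ENNReal.ofReal_mul (by positivity)]
  congr 2
  rw [← Nat.cast_succ, ENNReal.ofReal_natCast]

/-- Balls of a fixed radius centred in a compact subset of the support have mass bounded below. -/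
theorem exists_pos_le_measure_ball {E : Type*} [PseudoMetricSpace E] [MeasurableSpace E]
    {μ : Measure E} {A : Set E} (hA : IsCompact A) (hsupp : A ⊆ μ.support) {r : ℝ} (hr : 0 < r) :
    ∃ m : ℝ≥0∞, 0 < m ∧ ∀ y ∈ A, m ≤ μ (Metric.ball y r) := by
  -- Half the radius, so that the ball of radius `r` at any `y ∈ A` contains a whole ball of the
  -- finite cover.
  obtain ⟨t, htA, htc⟩ := hA.elim_nhds_subcover (fun x => Metric.ball x (r / 2))
    fun x _ => Metric.ball_mem_nhds x (half_pos hr)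
  refine ⟨t.inf fun x => μ (Metric.ball x (r / 2)), ?_, fun y hy => ?_⟩
  · rw [Finset.lt_inf_iff ENNReal.zero_lt_top]
    exact fun x hx => Measure.mem_support_iff_forall x |>.1 (hsupp (htA x hx)) _
      (Metric.ball_mem_nhds x (half_pos hr))
  · obtain ⟨x, hx, hyx⟩ := Set.mem_iUnion₂.1 (htc hy)
    refine (Finset.inf_le hx).trans (measure_mono (Metric.ball_subset_ball' ?_))
    rw [dist_comm]
    linarith [Metric.mem_ball.1 hyx]

/-- If a measurable set `B` has distance at least `r` to the range of `G`, then transporting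
`G_{♯U}` to `μ` costs at least `r * μ B`. -/
theorem mul_measure_le_W1_pushUniform {d : ℕ} {G : unitInterval → EuclideanSpace ℝ (Fin d)}
    (hG : Continuous G) (μ : Measure (EuclideanSpace ℝ (Fin d)))
    {B : Set (EuclideanSpace ℝ (Fin d))} (hB : MeasurableSet B) {r : ℝ}
    (hr : ∀ y ∈ B, ∀ t, r ≤ dist (G t) y) :
    ENNReal.ofReal r * μ B ≤ W1 (pushUniform G) μ := by
  refine le_iInf₂ fun π ⟨_, hfst, hsnd⟩ => ?_
  -- Any coupling starts on the curve, so mass ending in `B` pays at least `r`.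
  have hrange : ∀ᵐ z ∂π, z.1 ∈ Set.range G := by
    have hmeas : MeasurableSet (Set.range G) := (isCompact_range hG).measurableSet
    have h : ∀ᵐ x ∂π.fst, x ∈ Set.range G := by
      rw [hfst]
      exact (ae_map_iff hG.measurable.aemeasurable hmeas).2
        (Eventually.of_forall fun t => Set.mem_range_self t)
    exact ae_of_ae_map measurable_fst.aemeasurable h
  have hB' : MeasurableSet (Prod.snd ⁻¹' B : Set (EuclideanSpace ℝ (Fin d) × _)) :=
    measurable_snd hB
  calc ENNReal.ofReal r * μ B
      = ∫⁻ z, (Prod.snd ⁻¹' B).indicator (fun _ => ENNReal.ofReal r) z ∂π := by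
        rw [lintegral_indicator_const hB', ← hsnd, Measure.snd_apply hB]
    _ ≤ ∫⁻ z, ‖z.1 - z.2‖ₑ ∂π := by
        refine lintegral_mono_ae (hrange.mono fun z hz => ?_)
        obtain ⟨t, ht⟩ := hz
        refine Set.indicator_apply_le' (fun hzB => ?_) fun _ => zero_le
        rw [← ofReal_norm, ← dist_eq_norm, ← ht]
        exact ENNReal.ofReal_le_ofReal (hr _ hzB t)

/-- If the support of `μ` has positive volume, then `K`-Lipschitz images of the uniform
distribution stay at a distance from `μ` bounded away from zero. -/
theorem exists_pos_le_W1_pushUniform {d : ℕ} (hd : 1 < d)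
    (μ : Measure (EuclideanSpace ℝ (Fin d)))
    (hS : 0 < (volume : Measure (EuclideanSpace ℝ (Fin d))) μ.support) {K : ℝ≥0} (hK : 0 < K) :
    ∃ c : ℝ≥0∞, 0 < c ∧ ∀ G ∈ lipClass d K, c ≤ W1 (pushUniform G) μ := by
  obtain ⟨A, hAS, hA, hApos⟩ :=
    (Measure.isClosed_support (μ := μ)).measurableSet.exists_lt_isCompact hS
  -- `N` and `m` are fixed before `G`, which makes `c` uniform.
  obtain ⟨N, hNlt, hN⟩ := (((tendsto_mul_volume_closedBall_div hd
    (C := 2 * K) (by positivity)).eventually_lt_const hApos).and (eventually_gt_atTop 0)).exists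
  have hε : (0 : ℝ) < K / N := div_pos hK (by exact_mod_cast hN)
  obtain ⟨m, hm, hmA⟩ := exists_pos_le_measure_ball hA hAS (half_pos hε)
  refine ⟨ENNReal.ofReal (K / N / 2) * m,
    ENNReal.mul_pos (by simpa using half_pos hε) hm.ne', fun G hG => ?_⟩
  have hnot : ¬ A ⊆ {y | ∃ t, dist y (G t) ≤ K / N} := fun h =>
    (((measure_mono h).trans (volume_setOf_dist_range_le hG hN)).trans_lt hNlt).false
  obtain ⟨y, hyA, hy⟩ := Set.not_subset.1 hnot
  simp only [Set.mem_ofPred_eq, not_exists, not_le] at hy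
  refine (mul_le_mul_right (hmA y hyA) _).trans
    (mul_measure_le_W1_pushUniform hG.continuous μ measurableSet_ball fun x hx t => ?_)
  linarith [hy t, dist_triangle y x (G t), dist_comm x y, dist_comm x (G t), Metric.mem_ball.1 hx]

theorem mainTheorem5 {d : ℕ} (hd : 1 < d)
    (μ : Measure (EuclideanSpace ℝ (Fin d))) [IsProbabilityMeasure μ]
    (hμ : Integrable (fun x => ‖x‖) μ)
    (hS : 0 < (volume : Measure (EuclideanSpace ℝ (Fin d))) μ.support)
    {Ω : Type*} [MeasurableSpace Ω] (P : Measure Ω) [IsProbabilityMeasure P]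
    (X : ℕ → Ω → EuclideanSpace ℝ (Fin d))
    (hX : ∀ i, Measurable (X i)) (hindep : iIndepFun X P) (hlaw : ∀ i, P.map (X i) = μ)
    (K : ℝ≥0) (hK : 0 < K)
    (Ghat : ℕ → Ω → unitInterval → EuclideanSpace ℝ (Fin d))
    (hG : ∀ᵐ ω ∂P, ∀ n : ℕ, 1 ≤ n →
      Ghat n ω ∈ wganMinimizers K (empiricalMeasure (fun i => X i ω) n)) :
    ∀ᵐ ω ∂P, 0 < liminf (fun n : ℕ => W1 (pushUniform (Ghat n ω)) μ) atTop := by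
  obtain ⟨c, hc, hle⟩ := exists_pos_le_W1_pushUniform hd μ hS hK
  filter_upwards [hG] with ω hω
  refine hc.trans_le (le_liminf_of_le (by isBoundedDefault) ?_)
  filter_upwards [eventually_ge_atTop 1] with n hn
  exact hle _ (hω n hn).1
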